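/- For a set $A$ let $D(A)$ be the set of finitely supported probability distributions on $A$, $D(h)$ the push-forward along a map $h$, and $\delta_A\colon A\to D(A)$ the map sending $a$ to the point mass at $a$; $D$ and $\delta$ are applied degreewise to simplicial sets. Convex sets are algebras over the monad $D$, and convex maps are maps preserving finite convex combinations; the set $\mathbf{Conv}(A,B)$ of convex maps $A\to B$ is a convex set pointwise. A simplicial bundle scenario is a map of simplicial sets $f\colon E\to X$. A morphism from $f\colon E\to X$ to $g\colon F\to Y$ in the category $\mathsf{sScen}$ is a pair $(\pi,\alpha)$ of simplicial maps $\pi\colon Y\to X$ and $\alpha\colon \pi^*(E)=E\times_X Y\to F$ such that $g\circ\alpha$ is the projection to $Y$; the composite of $(\pi,\alpha)$ followed by $(\pi',\alpha')$ is $(\pi\circ\pi',\ \alpha'\circ\pi'^*(\alpha))$. A simplicial distribution on $f$ is a simplicial map $p\colon X\to D(E)$ with $D(f)\circ p=\delta_X$; these form a convex set $\mathsf{sDist}(f)$ pointwise. A morphism $(\pi,\alpha)\colon f\to g$ induces the convex map $\mathsf{sDist}(\pi,\alpha)\colon\mathsf{sDist}(f)\to\mathsf{sDist}(g)$, $p\mapsto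 D(\alpha)\circ\pi^*(p)$, where $\pi^*(p)_y(e,y')=p_{\pi(y)}(e)$ if $y'=y$ and $0$ otherwise. A simplicial distribution on $f$ is noncontextual if it is a finite convex combination of distributions of the form $\delta_E\circ s$ with $s$ a section of $f$, that is, if it lies in the image of the convex map $\Theta_f\colon D(\mathsf{Sect}(f))\to\mathsf{sDist}(f)$ extending $s\mapsto\delta_E\circ s$. For $y\in Y_n$ let $g_y\colon y^*(F)\to\Delta^n$ be the pullback of $g$ along $y\colon\Delta^n\to Y$. The mapping scenario $\mathrm{Map}(f,g)\colon E(f,g)\to Y$ has $E(f,g)_n=\coprod_{y\in Y_n}\mathsf{sScen}(f,g_y)$, with an ordinal map $\theta\colon[m]\to[n]$ acting by composition with the canonical morphism $(\theta,\mathrm{Id})\colon g_y\to g_{y\circ\theta}$, and it projects to $Y$ by $\mathsf{sScen}(f,g_y)\mapsto y$. The convex map $$\mu_{f,g}\colon\mathsf{sDist}(\mathrm{Map}(f,g))\to\mathbf{Conv}(\mathsf{sDist}(f),\mathsf{sDist}(g))$$ is given, for $p\in\mathsf{sDist}(\mathrm{Map}(f,g))$, $q\in\mathsf{sDist}(f)$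 and $y\in Y_n$, by $$\mu_{f,g}(p)(q)_y=\sum_{m\in\mathsf{sScen}(f,g_y)}p_y(m)\,\mathsf{sDist}(m)(q)\ \in\ \mathsf{sDist}(g_y)\cong D(g_n^{-1}(y))\subseteq D(F_n),$$ where the identification evaluates a distribution on $g_y$ at the nondegenerate $n$-simplex of $\Delta^n$. Theorem. Let $f$ and $g$ be simplicial bundle scenarios and let $\varphi\colon\mathsf{sDist}(f)\to\mathsf{sDist}(g)$ be a convex map. Then $\varphi$ is a (finite) convex combination of maps $\mathsf{sDist}(\pi,\alpha)$ induced by morphisms $(\pi,\alpha)\in\mathsf{sScen}(f,g)$ if and only if there exists a noncontextual simplicial distribution $p$ on $\mathrm{Map}(f,g)$ such that $\varphi=\mu_{f,g}(p)$. -/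

import Mathlib

open CategoryTheory Opposite Convexity

universe u

namespace SimplicialScenario

noncomputable section

/-! ### Finitely supported distributions

The set `D(A)` of finitely supported probability distributions on a set `A` is
`Convexity.StdSimplex ℝ A`; convex sets are algebras over the monad `D`, that is, instances of
`Convexity.ConvexSpace ℝ`, and convex maps are `Convexity.ConvexSpace.AffineMap ℝ`. -/

section Distributions

variable {A B C : Type u}

theorem map_congr_support (p : StdSimplex ℝ A) {h k : A → B}
    (H : ∀ a, p.weights a ≠ 0 → h a = k a) : p.map h = p.map k := by
  apply StdSimplex.ext
  simp only [StdSimplex.weights_map]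
  exact Finsupp.mapDomain_congr fun a ha => H a (by simpa using ha)

theorem eq_of_weights_ne_zero (p : StdSimplex ℝ A) {h : A → B} {b : B}
    (hp : p.map h = StdSimplex.single b) {a : A} (ha : p.weights a ≠ 0) : h a = b := by
  classical
  by_contra hne
  have h1 : (p.map h).weights (h a) = 0 := by
    rw [hp]; simp [Ne.symm hne]
  rw [StdSimplex.weights_map, Finsupp.mapDomain, Finsupp.sum_apply, Finsupp.sum,
    Finset.sum_eq_zero_iff_of_nonneg] at h1
  · have := h1 a (by simpa using ha)
    simp at this
    exact ha this
  · intro i _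
    rw [Finsupp.single_apply]
    split_ifs
    · exact p.nonneg i
    · exact le_rfl

theorem map_injective {h : A → B} (hh : Function.Injective h) :
    Function.Injective (StdSimplex.map (R := ℝ) h) := by
  intro p q hpq
  apply StdSimplex.ext
  exact Finsupp.mapDomain_injective hh (by simpa using congrArg StdSimplex.weights hpq)

/-- A distribution on `A` that is supported on the fiber `h ⁻¹ {b}`, viewed as a distribution on
that fiber. -/
def fiberRestrict (h : A → B) (b : B) (p : StdSimplex ℝ A)
    (hp : p.map h = StdSimplex.single b) : StdSimplex ℝ {a : A // h a = b} where
  weights := p.weights.subtypeDomain fun a => h a = b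
  nonneg := fun a => p.nonneg a.1
  total := by
    rw [Finsupp.sum_subtypeDomain_index (h := fun _ r => r)]
    · exact p.total
    · intro a ha
      exact eq_of_weights_ne_zero p hp (by simpa using ha)

theorem fiberRestrict_map_val (h : A → B) (b : B) (p : StdSimplex ℝ A)
    (hp : p.map h = StdSimplex.single b) :
    (fiberRestrict h b p hp).map Subtype.val = p := by
  classical
  apply StdSimplex.ext
  ext a
  rw [StdSimplex.weights_map]
  by_cases ha : h a = b
  · exact Finsupp.mapDomain_apply Subtype.val_injective (fiberRestrict h b p hp).weights ⟨a, ha⟩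
  · rw [Finsupp.mapDomain_of_notMem_range _ _ (by simpa using ha)]
    by_contra hne
    exact ha (eq_of_weights_ne_zero p hp (Ne.symm hne))

/-- A distribution on a set of pairs whose second marginal is a delta distribution is determined
by its first marginal. -/
theorem ext_of_marginals {P : A × B → Prop} {q q' : StdSimplex ℝ {z : A × B // P z}} {b : B}
    (hq : q.map (fun z => z.1.2) = StdSimplex.single b)
    (hq' : q'.map (fun z => z.1.2) = StdSimplex.single b)
    (h : q.map (fun z => z.1.1) = q'.map (fun z => z.1.1)) : q = q' := by
  have key : ∀ r : StdSimplex ℝ {z : A × B // P z},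
      r.map (fun z => z.1.2) = StdSimplex.single b →
      r.map Subtype.val = (r.map (fun z => z.1.1)).map (fun a => (a, b)) := by
    intro r hr
    rw [StdSimplex.map_map]
    apply map_congr_support
    intro z hz
    exact Prod.ext rfl (eq_of_weights_ne_zero r hr hz)
  apply map_injective Subtype.val_injective
  rw [key q hq, key q' hq', h]

/-- Gluing of a distribution `p` on `A` with an element `b` of `B` lying over the same element of
`C`: the distribution on `A ×_C B` whose first marginal is `p` and whose second marginal is the
delta distribution at `b`. -/
def glue (h : A → C) (k : B → C) (p : StdSimplex ℝ A) (b : B)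
    (hp : p.map h = StdSimplex.single (k b)) : StdSimplex ℝ {z : A × B // h z.1 = k z.2} :=
  (fiberRestrict h (k b) p hp).map fun a => ⟨(a.1, b), a.2⟩

theorem glue_map_fst (h : A → C) (k : B → C) (p : StdSimplex ℝ A) (b : B)
    (hp : p.map h = StdSimplex.single (k b)) :
    (glue h k p b hp).map (fun z => z.1.1) = p := by
  rw [glue, StdSimplex.map_map]
  exact fiberRestrict_map_val h (k b) p hp

theorem glue_map_snd (h : A → C) (k : B → C) (p : StdSimplex ℝ A) (b : B)
    (hp : p.map h = StdSimplex.single (k b)) :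
    (glue h k p b hp).map (fun z => z.1.2) = StdSimplex.single b := by
  rw [glue, StdSimplex.map_map]
  exact StdSimplex.map_const _ _

/-- The weights of the glued distribution. -/
theorem glue_weights [DecidableEq B] (h : A → C) (k : B → C) (p : StdSimplex ℝ A) (b : B)
    (hp : p.map h = StdSimplex.single (k b)) (z : {z : A × B // h z.1 = k z.2}) :
    (glue h k p b hp).weights z = if z.1.2 = b then p.weights z.1.1 else 0 := by
  have h1 : (glue h k p b hp).map Subtype.val = p.map fun a => (a, b) := by
    conv_rhs => rw [← fiberRestrict_map_val h (k b) p hp]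
    rw [glue, StdSimplex.map_map, StdSimplex.map_map]
  have h2 : (glue h k p b hp).weights z =
      ((glue h k p b hp).map Subtype.val).weights z.1 := by
    rw [StdSimplex.weights_map]
    exact (Finsupp.mapDomain_apply Subtype.val_injective _ z).symm
  rw [h2, h1, StdSimplex.weights_map]
  obtain ⟨⟨a, b'⟩, hz⟩ := z
  split_ifs with hb
  · obtain rfl : b' = b := hb
    exact Finsupp.mapDomain_apply (fun _ _ e => congrArg Prod.fst e) p.weights a
  · refine Finsupp.mapDomain_of_notMem_range _ _ ?_
    rintro ⟨a', ha'⟩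
    exact hb (congrArg Prod.snd ha').symm

end Distributions

/-! ### The convex set of convex maps -/

section AffineMaps

variable {M N : Type*} [ConvexSpace ℝ M] [ConvexSpace ℝ N]

/-- The convex maps `M → N` form a convex set under pointwise convex combinations. -/
instance : ConvexSpace ℝ (ConvexSpace.AffineMap ℝ M N) :=
  ConvexSpace.mk
    (fun w =>
      { toFun := fun x => w.iConvexComb fun k => k x
        isAffineMap_toFun := ⟨fun s => by
          rw [show (fun k : ConvexSpace.AffineMap ℝ M N => k s.sConvexComb) =
              fun k => s.iConvexComb (fun x => k x) from
            funext fun k => k.isAffineMap.map_sConvexComb s]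
          rw [iConvexComb_comm]
          rfl⟩ })
    (fun k => by ext x; exact iConvexComb_single k _)
    (fun F => by
      ext x
      change (F.map _).iConvexComb _ = F.sConvexComb.iConvexComb _
      rw [iConvexComb_map, ← iConvexComb_id' F, ← iConvexComb_assoc]
      rfl)

theorem affineMap_iConvexComb_apply {I : Type*} (w : StdSimplex ℝ I)
    (k : I → ConvexSpace.AffineMap ℝ M N) (x : M) :
    (w.iConvexComb k) x = w.iConvexComb fun i => k i x :=
  iConvexComb_map w k fun j : ConvexSpace.AffineMap ℝ M N => j x

end AffineMaps

/-! ### Simplicial sets of distributions -/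

theorem sset_hom_ext {A B : SSet.{u}} {h k : A ⟶ B}
    (H : ∀ (n : SimplexCategoryᵒᵖ) (a : A.obj n), h.app n a = k.app n a) : h = k :=
  SSet.hom_ext fun n => ConcreteCategory.hom_ext _ _ fun a => H n a

/-- The distribution monad on simplicial sets, applied degreewise. -/
def D : SSet.{u} ⥤ SSet.{u} where
  obj A :=
    { obj := fun n => StdSimplex ℝ (A.obj n)
      map := fun θ => ↾(StdSimplex.map (A.map θ))
      map_id := fun n => ConcreteCategory.hom_ext _ _ fun p => by
        change StdSimplex.map (A.map (𝟙 n)) p = p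
        rw [A.map_id]
        exact StdSimplex.map_id p
      map_comp := fun θ θ' => ConcreteCategory.hom_ext _ _ fun p => by
        change StdSimplex.map (A.map (θ ≫ θ')) p = (p.map (A.map θ)).map (A.map θ')
        rw [A.map_comp, StdSimplex.map_map]
        rfl }
  map h :=
    { app := fun n => ↾(StdSimplex.map (h.app n))
      naturality := fun m n θ => ConcreteCategory.hom_ext _ _ fun p => by
        change (p.map _).map _ = (p.map _).map _
        rw [StdSimplex.map_map, StdSimplex.map_map]
        exact congrArg (fun k => p.map k) (funext fun a => NatTrans.naturality_apply h θ a) }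
  map_id _ := sset_hom_ext fun _ p => StdSimplex.map_id p
  map_comp h k := sset_hom_ext fun n p => StdSimplex.map_comp p (h.app n) (k.app n)

/-- The unit `δ_A : A → D(A)`, sending a simplex to its delta distribution. -/
def dirac (A : SSet.{u}) : A ⟶ D.obj A where
  app n := ↾(fun a => (StdSimplex.single a : StdSimplex ℝ (A.obj n)))
  naturality m n θ := by
    ext a
    exact (StdSimplex.map_single a _).symm

/-! ### Pullbacks and simplicial scenarios -/

/-- The pullback `π^*(E) = E ×_X Y` of `f : E → X` along `π : Y → X`. -/
def pullback {E X Y : SSet.{u}} (f : E ⟶ X) (π : Y ⟶ X) : SSet.{u} where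
  obj n := {z : E.obj n × Y.obj n // f.app n z.1 = π.app n z.2}
  map θ := ↾(fun z => ⟨(E.map θ z.1.1, Y.map θ z.1.2), by
    rw [NatTrans.naturality_apply, NatTrans.naturality_apply, z.2]⟩)
  map_id n := ConcreteCategory.hom_ext _ _ fun z => Subtype.ext (Prod.ext
    (by change E.map (𝟙 n) z.1.1 = z.1.1; rw [E.map_id]; rfl)
    (by change Y.map (𝟙 n) z.1.2 = z.1.2; rw [Y.map_id]; rfl))
  map_comp θ θ' := ConcreteCategory.hom_ext _ _ fun z => Subtype.ext (Prod.ext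
    (by change E.map (θ ≫ θ') z.1.1 = E.map θ' (E.map θ z.1.1); rw [E.map_comp]; rfl)
    (by change Y.map (θ ≫ θ') z.1.2 = Y.map θ' (Y.map θ z.1.2); rw [Y.map_comp]; rfl))

/-- The projection `π^*(E) → E`. -/
def pullbackFst {E X Y : SSet.{u}} (f : E ⟶ X) (π : Y ⟶ X) : pullback f π ⟶ E where
  app n := ↾(fun z => z.1.1)
  naturality _ _ _ := rfl

/-- The projection `π^*(f) : π^*(E) → Y`. -/
def pullbackSnd {E X Y : SSet.{u}} (f : E ⟶ X) (π : Y ⟶ X) : pullback f π ⟶ Y where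
  app n := ↾(fun z => z.1.2)
  naturality _ _ _ := rfl

/-- The map into the pullback induced by a commutative square. -/
def pullbackLift {E X Y W : SSet.{u}} (f : E ⟶ X) (π : Y ⟶ X) (a : W ⟶ E) (b : W ⟶ Y)
    (h : a ≫ f = b ≫ π) : W ⟶ pullback f π where
  app n := ↾(fun w => ⟨(a.app n w, b.app n w), congrArg (fun k : W ⟶ X => k.app n w) h⟩)
  naturality _ _ θ := ConcreteCategory.hom_ext _ _ fun w => Subtype.ext (Prod.ext
    (NatTrans.naturality_apply a θ w) (NatTrans.naturality_apply b θ w))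

end

end SimplicialScenario

open SimplicialScenario

noncomputable section

/-- A simplicial bundle scenario: a map of simplicial sets `f : E → X` from the space of events to
the space of measurements. -/
structure SScen : Type (u + 1) where
  /-- The space of events. -/
  E : SSet.{u}
  /-- The space of measurements. -/
  X : SSet.{u}
  /-- The structure map. -/
  hom : E ⟶ X

namespace SScen

/-- A morphism `(π, α) : f → g` of simplicial scenarios: a map `π : Y → X` of measurement spaces
(in the opposite direction) and a map `α : π^*(E) → F` over `Y`. -/
structure Hom (f g : SScen.{u}) : Type u where
  /-- The map of measurement spaces. -/
  π : g.X ⟶ f.X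
  /-- The map of event spaces. -/
  α : pullback f.hom π ⟶ g.E
  w : α ≫ g.hom = pullbackSnd f.hom π

theorem Hom.w_apply {f g : SScen.{u}} (a : Hom f g) {n : SimplexCategoryᵒᵖ}
    (z : (pullback f.hom a.π).obj n) : g.hom.app n (a.α.app n z) = z.1.2 :=
  congrArg (fun k : pullback f.hom a.π ⟶ g.X => k.app n z) a.w

theorem Hom.ext' {f g : SScen.{u}} {a b : Hom f g}
    (hπ : ∀ n (y : g.X.obj n), a.π.app n y = b.π.app n y)
    (hα : ∀ n (e : f.E.obj n) (y : g.X.obj n) h h',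
      a.α.app n ⟨(e, y), h⟩ = b.α.app n ⟨(e, y), h'⟩) : a = b := by
  obtain ⟨π, α, w⟩ := a
  obtain ⟨π', α', w'⟩ := b
  obtain rfl : π = π' := sset_hom_ext hπ
  obtain rfl : α = α' := sset_hom_ext fun n z => hα n z.1.1 z.1.2 z.2 z.2
  rfl

/-- The map `π'^*(α) : π'^*(π^*(E)) → π'^*(F)`, where `π'^*(π^*(E))` is identified with
`(π ∘ π')^*(E)`: it sends `(e, z)` to `(α(e, π'(z)), z)`. -/
def Hom.pullbackMap {f g : SScen.{u}} (a : Hom f g) {Z : SSet.{u}} (π' : Z ⟶ g.X) :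
    pullback f.hom (π' ≫ a.π) ⟶ pullback g.hom π' :=
  pullbackLift g.hom π'
    (pullbackLift f.hom a.π (pullbackFst f.hom (π' ≫ a.π)) (pullbackSnd f.hom (π' ≫ a.π) ≫ π')
      (sset_hom_ext fun _ z => z.2) ≫ a.α)
    (pullbackSnd f.hom (π' ≫ a.π))
    (by rw [Category.assoc, a.w]; rfl)

/-- The identity morphism. -/
def Hom.id (f : SScen.{u}) : Hom f f where
  π := 𝟙 f.X
  α := pullbackFst f.hom (𝟙 f.X)
  w := sset_hom_ext fun _ z => z.2

/-- The composite of `(π, α) : f → g` and `(π', α') : g → h` is `(π ∘ π', α' ∘ π'^*(α))`. -/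
def Hom.comp {f g h : SScen.{u}} (a : Hom f g) (b : Hom g h) : Hom f h where
  π := b.π ≫ a.π
  α := a.pullbackMap b.π ≫ b.α
  w := by rw [Category.assoc, b.w]; rfl

/-- The category of simplicial scenarios. -/
instance : Category.{u} SScen.{u} where
  Hom := Hom
  id f := Hom.id f
  comp a b := a.comp b
  id_comp _ := Hom.ext' (fun _ _ => rfl) (fun _ _ _ _ _ => rfl)
  comp_id _ := Hom.ext' (fun _ _ => rfl) (fun _ _ _ _ _ => rfl)
  assoc _ _ _ := Hom.ext' (fun _ _ => rfl) (fun _ _ _ _ _ => rfl)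

/-! ### Sections, simplicial distributions, contextuality -/

/-- The set of sections of `f`. -/
def Sect (f : SScen.{u}) : Type u := {s : f.X ⟶ f.E // s ≫ f.hom = 𝟙 f.X}

/-- A simplicial distribution on `f : E → X`: a map of simplicial sets `p : X → D(E)` such that
`D(f) ∘ p = δ_X`. -/
@[ext]
structure SDist (f : SScen.{u}) : Type u where
  /-- The underlying map of simplicial sets. -/
  toHom : f.X ⟶ D.obj f.E
  w : toHom ≫ D.map f.hom = dirac f.X

namespace SDist

variable {f : SScen.{u}}

/-- The distribution `p_x` on `E_n` assigned to a simplex `x ∈ X_n`. -/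
def at' (p : SDist f) {n : SimplexCategoryᵒᵖ} (x : f.X.obj n) : StdSimplex ℝ (f.E.obj n) :=
  p.toHom.app n x

theorem at'_map_hom (p : SDist f) {n : SimplexCategoryᵒᵖ} (x : f.X.obj n) :
    (p.at' x).map (f.hom.app n) = StdSimplex.single x :=
  congrArg (fun k : f.X ⟶ D.obj f.X => k.app n x) p.w

theorem at'_map (p : SDist f) {m n : SimplexCategoryᵒᵖ} (θ : m ⟶ n) (x : f.X.obj m) :
    p.at' (f.X.map θ x) = (p.at' x).map (f.E.map θ) :=
  NatTrans.naturality_apply p.toHom θ x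

theorem ext_at {p q : SDist f}
    (h : ∀ (n : SimplexCategoryᵒᵖ) (x : f.X.obj n), p.at' x = q.at' x) : p = q :=
  SDist.ext (sset_hom_ext h)

/-- A simplicial distribution as a compatible family of distributions. -/
def mk' (P : ∀ {n : SimplexCategoryᵒᵖ}, f.X.obj n → StdSimplex ℝ (f.E.obj n))
    (hmap : ∀ {m n : SimplexCategoryᵒᵖ} (θ : m ⟶ n) (x : f.X.obj m),
      P (f.X.map θ x) = (P x).map (f.E.map θ))
    (hw : ∀ {n : SimplexCategoryᵒᵖ} (x : f.X.obj n),
      (P x).map (f.hom.app n) = StdSimplex.single x) : SDist f where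
  toHom :=
    { app := fun n => ↾(fun x => P x)
      naturality := fun m n θ => ConcreteCategory.hom_ext _ _ fun x => hmap θ x }
  w := sset_hom_ext fun _ x => hw x

/-- Simplicial distributions form a convex set under pointwise convex combinations. -/
instance : ConvexSpace ℝ (SDist f) :=
  ConvexSpace.mk
    (fun w => mk' (fun x => w.iConvexComb fun p => p.at' x)
      (fun θ x => by
        rw [map_iConvexComb]
        exact congrArg w.iConvexComb (funext fun p => p.at'_map θ x))
      (fun x => by
        rw [map_iConvexComb, show (StdSimplex.map (f.hom.app _) ∘ fun p : SDist f => p.at' x) =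
          fun _ => StdSimplex.single x from funext fun p => p.at'_map_hom x]
        exact iConvexComb_const _ _))
    (fun p => ext_at fun _ x => by
      exact iConvexComb_single (R := ℝ) p fun q : SDist f => q.at' x)
    (fun F => ext_at fun _ x => by
      change (F.map _).iConvexComb _ = F.sConvexComb.iConvexComb _
      rw [iConvexComb_map, ← iConvexComb_id' F, ← iConvexComb_assoc]
      rfl)

theorem iConvexComb_at {I : Type*} (w : StdSimplex ℝ I) (p : I → SDist f)
    {n : SimplexCategoryᵒᵖ} (x : f.X.obj n) :
    (w.iConvexComb p).at' x = w.iConvexComb fun i => (p i).at' x :=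
  iConvexComb_map w p fun q : SDist f => q.at' x

/-- The inclusion `(δ_E)_*` of sections into simplicial distributions. -/
def ofSect (s : Sect f) : SDist f where
  toHom := s.1 ≫ dirac f.E
  w := by
    rw [Category.assoc, show dirac f.E ≫ D.map f.hom = f.hom ≫ dirac f.X from ?_,
      ← Category.assoc, s.2, Category.id_comp]
    exact sset_hom_ext fun _ e => StdSimplex.map_single e _

/-- The map `Θ_f : D(Sect(f)) → sDist(f)`, the convex extension of `(δ_E)_*`. -/
def Θ (f : SScen.{u}) (d : StdSimplex ℝ (Sect f)) : SDist f := d.iConvexComb ofSect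

/-- `p` is noncontextual if it lies in the image of `Θ_f`. -/
def Noncontextual (p : SDist f) : Prop := p ∈ Set.range (Θ f)

/-- The pullback `π^*(p)` of a simplicial distribution, as a simplicial distribution on the
projection `π^*(E) → Y`: the probability of `(e, y')` under `π^*(p)_y` is `p_{π(y)}(e)` if
`y' = y`, and `0` otherwise. -/
def pullback (p : SDist f) {Y : SSet.{u}} (π : Y ⟶ f.X) :
    SDist ⟨SimplicialScenario.pullback f.hom π, Y, pullbackSnd f.hom π⟩ :=
  mk' (fun {n} y => glue (f.hom.app n) (π.app n) (p.at' (π.app n y)) y (p.at'_map_hom _))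
    (fun {m n} θ y => by
      refine ext_of_marginals (b := Y.map θ y) (glue_map_snd _ _ _ _ _) ?_ ?_
      · refine (StdSimplex.map_map _ _ _).trans ?_
        refine (StdSimplex.map_map _
          (fun z : {z : f.E.obj m × Y.obj m // _} => z.1.2) (Y.map θ)).symm.trans ?_
        rw [glue_map_snd, StdSimplex.map_single]
      · refine (glue_map_fst _ _ _ _ _).trans ?_
        refine Eq.trans ?_ (StdSimplex.map_map _ _ _).symm
        refine Eq.trans ?_ (StdSimplex.map_map (glue (f.hom.app m) (π.app m)
          (p.at' (π.app m y)) y (p.at'_map_hom _))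
          (fun z : {z : f.E.obj m × Y.obj m // _} => z.1.1) (f.E.map θ))
        rw [glue_map_fst, ← p.at'_map]
        exact congrArg p.at' (NatTrans.naturality_apply π θ y))
    (fun y => glue_map_snd _ _ _ _ _)

/-- A morphism `(π, α) : f → g` sends a simplicial distribution `p` on `f` to the simplicial
distribution `D(α) ∘ π^*(p)` on `g`. -/
def push {f g : SScen.{u}} (a : f ⟶ g) (p : SDist f) : SDist g where
  toHom := (p.pullback a.π).toHom ≫ D.map a.α
  w := by
    rw [Category.assoc, ← D.map_comp, a.w]
    exact (p.pullback a.π).w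

theorem push_at {f g : SScen.{u}} (a : f ⟶ g) (p : SDist f) {n : SimplexCategoryᵒᵖ}
    (y : g.X.obj n) :
    (push a p).at' y = (glue (f.hom.app n) (a.π.app n) (p.at' (a.π.app n y)) y
      (p.at'_map_hom _)).map (a.α.app n) := rfl

theorem pullback_iConvexComb {I : Type*} (w : StdSimplex ℝ I) (p : I → SDist f) {Y : SSet.{u}}
    (π : Y ⟶ f.X) : (w.iConvexComb p).pullback π = w.iConvexComb fun i => (p i).pullback π := by
  refine ext_at fun n y => ?_
  rw [iConvexComb_at]
  refine ext_of_marginals (b := y) (glue_map_snd _ _ _ _ _) ?_ ?_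
  · refine (map_iConvexComb w _).trans ?_
    refine Eq.trans ?_ (iConvexComb_const w (StdSimplex.single y))
    exact congrArg w.iConvexComb (funext fun i => glue_map_snd _ _ _ _ _)
  · refine (glue_map_fst _ _ _ _ _).trans ?_
    refine Eq.trans ?_ (map_iConvexComb w _).symm
    rw [iConvexComb_at]
    exact congrArg w.iConvexComb (funext fun i => (glue_map_fst _ _ _ _ _).symm)

theorem push_iConvexComb {g : SScen.{u}} (a : f ⟶ g) {I : Type*} (w : StdSimplex ℝ I)
    (p : I → SDist f) : push a (w.iConvexComb p) = w.iConvexComb fun i => push a (p i) := by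
  refine ext_at fun n y => ?_
  rw [iConvexComb_at]
  change (((w.iConvexComb p).pullback a.π).at' y).map (a.α.app n) = _
  rw [pullback_iConvexComb, iConvexComb_at]
  exact map_iConvexComb w _

theorem push_comp {g h : SScen.{u}} (a : f ⟶ g) (b : g ⟶ h) (p : SDist f) :
    push (a ≫ b) p = push b (push a p) := by
  refine ext_at fun n z => ?_
  refine (push_at (a ≫ b) p z).trans (Eq.trans ?_ (push_at b (push a p) z).symm)
  refine (StdSimplex.map_comp _ ((Hom.pullbackMap a b.π).app n) (b.α.app n)).trans ?_
  refine congrArg (StdSimplex.map (b.α.app n)) ?_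
  refine ext_of_marginals (b := z) ?_ (glue_map_snd _ _ _ _ _) ?_
  · exact (StdSimplex.map_map _ _ _).trans (glue_map_snd _ _ _ _ _)
  · refine Eq.trans ?_ (glue_map_fst _ _ _ _ _).symm
    refine (StdSimplex.map_map _ _ _).trans ?_
    refine (StdSimplex.map_map _ _ _).trans (Eq.trans ?_ (StdSimplex.map_map _ _ _).symm)
    rfl

end SDist

/-- The convex map `sDist(f) → sDist(g)` induced by a morphism `f → g`. -/
def sDistMap {f g : SScen.{u}} (a : f ⟶ g) : ConvexSpace.AffineMap ℝ (SDist f) (SDist g) where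
  toFun := SDist.push a
  isAffineMap_toFun := ⟨fun s => by
    rw [← iConvexComb_id' s, SDist.push_iConvexComb]
    rfl⟩

/-! ### The mapping scenario -/

/-- The scenario `g_y : y^*(F) → Δ^n`, the pullback of `g` along the simplex `y : Δ^n → Y`. -/
def fib (g : SScen.{u}) {n : SimplexCategoryᵒᵖ} (y : g.X.obj n) : SScen.{u} where
  E := pullback g.hom (SSet.yonedaEquiv (n := n.unop).symm y)
  X := SSet.stdSimplex.obj n.unop
  hom := pullbackSnd g.hom (SSet.yonedaEquiv (n := n.unop).symm y)

/-- The morphism `(θ, Id) : g_y → g_{y ∘ θ}`, given by `θ : Δ^m → Δ^n` and the canonical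
identification of `θ^*(y^*(F))` with `(y ∘ θ)^*(F)`. -/
def fibMap (g : SScen.{u}) {n m : SimplexCategoryᵒᵖ} (θ : n ⟶ m) (y : g.X.obj n) :
    fib g y ⟶ fib g (g.X.map θ y) :=
  Hom.mk (f := fib g y) (g := fib g (g.X.map θ y)) (SSet.stdSimplex.map θ.unop)
    (pullbackLift g.hom (SSet.yonedaEquiv (n := m.unop).symm (g.X.map θ y))
      (pullbackFst (fib g y).hom (SSet.stdSimplex.map θ.unop) ≫
        pullbackFst g.hom (SSet.yonedaEquiv (n := n.unop).symm y))
      (pullbackSnd (fib g y).hom (SSet.stdSimplex.map θ.unop))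
      (sset_hom_ext fun k z => by
        have h1 : g.hom.app k z.1.1.1.1 =
          (SSet.yonedaEquiv (n := n.unop).symm y).app k z.1.1.1.2 := z.1.1.2
        have h2 : z.1.1.1.2 = (SSet.stdSimplex.map θ.unop).app k z.1.2 := z.2
        refine h1.trans ?_
        rw [h2]
        exact congrArg (fun j : SSet.stdSimplex.obj m.unop ⟶ g.X => j.app k z.1.2)
          (SSet.yonedaEquiv_symm_naturality_left (X := g.X) θ.unop y)))
    rfl

theorem mapE_ext {f g : SScen.{u}} {n : SimplexCategoryᵒᵖ}
    {z z' : Σ y : g.X.obj n, (f ⟶ fib g y)} (hy : z.1 = z'.1)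
    (hπ : ∀ k (t : (SSet.stdSimplex.obj n.unop).obj k), z.2.π.app k t = z'.2.π.app k t)
    (hα : ∀ k (e : f.E.obj k) (t : (SSet.stdSimplex.obj n.unop).obj k) h h',
      (z.2.α.app k ⟨(e, t), h⟩).1.1 = (z'.2.α.app k ⟨(e, t), h'⟩).1.1) : z = z' := by
  obtain ⟨y, a⟩ := z
  obtain ⟨y', a'⟩ := z'
  obtain rfl : y = y' := hy
  refine congrArg (Sigma.mk y) (Hom.ext' hπ fun k e t h h' => ?_)
  refine Subtype.ext (Prod.ext (hα k e t h h') ?_)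
  exact (a.w_apply ⟨(e, t), h⟩).trans (a'.w_apply ⟨(e, t), h'⟩).symm

theorem comp_fibMap_fst {f g : SScen.{u}} {n m : SimplexCategoryᵒᵖ} (θ : n ⟶ m) (y : g.X.obj n)
    (a : f ⟶ fib g y) {k : SimplexCategoryᵒᵖ} (e : f.E.obj k)
    (t : (SSet.stdSimplex.obj m.unop).obj k)
    (h : f.hom.app k e = (a ≫ fibMap g θ y).π.app k t) :
    ((a ≫ fibMap g θ y).α.app k ⟨(e, t), h⟩).1.1 =
      (a.α.app k ⟨(e, (SSet.stdSimplex.map θ.unop).app k t), h⟩).1.1 := rfl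

theorem mapE_id {f g : SScen.{u}} {n : SimplexCategoryᵒᵖ}
    (z : Σ y : g.X.obj n, (f ⟶ fib g y)) :
    (⟨g.X.map (𝟙 n) z.1, z.2 ≫ fibMap g (𝟙 n) z.1⟩ : Σ y : g.X.obj n, (f ⟶ fib g y)) = z := by
  have ht : ∀ k (t : (SSet.stdSimplex.obj n.unop).obj k),
      (SSet.stdSimplex.map (𝟙 n.unop)).app k t = t := fun k t =>
    congrArg (fun j : SSet.stdSimplex.obj n.unop ⟶ SSet.stdSimplex.obj n.unop => j.app k t)
      (SSet.stdSimplex.map_id _)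
  refine mapE_ext ?_ (fun k t => congrArg (z.2.π.app k) (ht k t)) (fun k e t h h' => ?_)
  · exact congrArg (fun j : g.X.obj n ⟶ g.X.obj n => j z.1) (g.X.map_id n)
  · refine (comp_fibMap_fst (𝟙 n) z.1 z.2 e t h).trans ?_
    exact congrArg (fun v => (z.2.α.app k v).1.1) (Subtype.ext (Prod.ext rfl (ht k t)))

theorem mapE_comp {f g : SScen.{u}} {n m l : SimplexCategoryᵒᵖ} (θ : n ⟶ m) (θ' : m ⟶ l)
    (z : Σ y : g.X.obj n, (f ⟶ fib g y)) :
    (⟨g.X.map (θ ≫ θ') z.1, z.2 ≫ fibMap g (θ ≫ θ') z.1⟩ : Σ y : g.X.obj l, (f ⟶ fib g y)) =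
      ⟨g.X.map θ' (g.X.map θ z.1),
        (z.2 ≫ fibMap g θ z.1) ≫ fibMap g θ' (g.X.map θ z.1)⟩ := by
  refine mapE_ext ?_ (fun k t => rfl) (fun k e t h h' => ?_)
  · exact congrArg (fun j : g.X.obj n ⟶ g.X.obj l => j z.1) (g.X.map_comp θ θ')
  · refine (comp_fibMap_fst (θ ≫ θ') z.1 z.2 e t h).trans ?_
    refine Eq.trans ?_ (comp_fibMap_fst θ' (g.X.map θ z.1) (z.2 ≫ fibMap g θ z.1) e t h').symm
    exact (comp_fibMap_fst θ z.1 z.2 e ((SSet.stdSimplex.map θ'.unop).app k t) h').symm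

/-- The space of events `E(f, g)` of the mapping scenario: its `n`-simplices are pairs of an
`n`-simplex `y` of `Y` and a morphism `f → g_y`, and an ordinal map `θ` acts by composition with
`(θ, Id) : g_y → g_{y ∘ θ}`. -/
def mapE (f g : SScen.{u}) : SSet.{u} where
  obj n := Σ y : g.X.obj n, (f ⟶ fib g y)
  map θ := ↾(fun z => ⟨g.X.map θ z.1, z.2 ≫ fibMap g θ z.1⟩)
  map_id n := ConcreteCategory.hom_ext _ _ fun z => mapE_id z
  map_comp θ θ' := ConcreteCategory.hom_ext _ _ fun z => mapE_comp θ θ' z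

/-- The simplicial mapping scenario `Map(f, g) : E(f, g) → Y`. -/
def Map (f g : SScen.{u}) : SScen.{u} where
  E := mapE f g
  X := g.X
  hom := { app := fun n => ↾(fun z : Σ y : g.X.obj n, (f ⟶ fib g y) => z.1), naturality := fun _ _ _ => rfl }

/-! ### The map `μ` -/

/-- The nondegenerate `n`-simplex of `Δ^n`. -/
def top (n : SimplexCategoryᵒᵖ) : (SSet.stdSimplex.{u}.obj n.unop).obj n :=
  SSet.stdSimplex.objEquiv.symm (𝟙 n.unop)

/-- The identification of `sDist(g_y)` with `D(g_n⁻¹(y))`, regarded as a set of distributions on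
`F_n`: evaluation at the nondegenerate `n`-simplex of `Δ^n`. -/
def evalTop (g : SScen.{u}) {n : SimplexCategoryᵒᵖ} (y : g.X.obj n) (r : SDist (fib g y)) :
    StdSimplex ℝ (g.E.obj n) :=
  (r.at' (top n)).map fun z => z.1.1

theorem evalTop_push_fibMap (g : SScen.{u}) {n m : SimplexCategoryᵒᵖ} (θ : n ⟶ m)
    (y : g.X.obj n) (r : SDist (fib g y)) :
    evalTop g (g.X.map θ y) (SDist.push (fibMap g θ y) r) =
      (evalTop g y r).map (g.E.map θ) := by
  have h1 : evalTop g (g.X.map θ y) (SDist.push (fibMap g θ y) r) =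
      (r.at' ((SSet.stdSimplex.map θ.unop).app m (top m))).map fun z => z.1.1 := by
    refine (StdSimplex.map_map _ _ _).trans ?_
    refine (StdSimplex.map_map _ (fun w : {w : (fib g y).E.obj m ×
      (SSet.stdSimplex.obj m.unop).obj m // _} => w.1.1)
      (fun z : (SimplicialScenario.pullback g.hom _).obj m => z.1.1)).symm.trans ?_
    exact congrArg (StdSimplex.map _) (glue_map_fst _ _ _ _ _)
  have h2 : (SSet.stdSimplex.map θ.unop).app m (top m) =
      (SSet.stdSimplex.obj n.unop).map θ (top n) := rfl
  rw [h1, h2]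
  refine (congrArg (StdSimplex.map _) (r.at'_map θ (top n))).trans ?_
  refine (StdSimplex.map_map _ _ _).trans ?_
  exact (StdSimplex.map_map (r.at' (top n))
    (fun z : (SimplicialScenario.pullback g.hom _).obj n => z.1.1) (g.E.map θ)).symm

theorem evalTop_map_hom (g : SScen.{u}) {n : SimplexCategoryᵒᵖ} (y : g.X.obj n)
    (r : SDist (fib g y)) : (evalTop g y r).map (g.hom.app n) = StdSimplex.single y := by
  refine (StdSimplex.map_map _ _ _).trans ?_
  refine Eq.trans (congrArg (fun k => StdSimplex.map k (r.at' (top n))) (funext fun z => z.2)) ?_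
  refine (StdSimplex.map_map _ (fun z : (fib g y).E.obj n => z.1.2)
    ((SSet.yonedaEquiv (n := n.unop).symm y).app n)).symm.trans ?_
  refine (congrArg (StdSimplex.map _) (r.at'_map_hom (top n))).trans ?_
  refine (StdSimplex.map_single _ _).trans ?_
  exact congrArg StdSimplex.single ((SSet.yonedaEquiv (n := n.unop)).apply_symm_apply y)

theorem evalTop_iConvexComb (g : SScen.{u}) {n : SimplexCategoryᵒᵖ} (y : g.X.obj n) {I : Type*}
    (w : StdSimplex ℝ I) (r : I → SDist (fib g y)) :
    evalTop g y (w.iConvexComb r) = w.iConvexComb fun i => evalTop g y (r i) :=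
  (congrArg (StdSimplex.map _) (SDist.iConvexComb_at w r (top n))).trans (map_iConvexComb w _)

/-- The distribution on `g_n⁻¹(y) ⊆ F_n` obtained from a simplicial distribution `q` on `f` and a
morphism `m : f → g_y`, through `sDist(m)(q) ∈ sDist(g_y) ≅ D(g_n⁻¹(y))`. -/
def evalHom {f g : SScen.{u}} {n : SimplexCategoryᵒᵖ} (q : SDist f)
    (z : Σ y : g.X.obj n, (f ⟶ fib g y)) : StdSimplex ℝ (g.E.obj n) :=
  evalTop g z.1 (sDistMap z.2 q)

/-- The distribution `p_y` on `E(f, g)_n` assigned by a simplicial distribution `p` on `Map(f, g)`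
to `y ∈ Y_n`. -/
def mapAt {f g : SScen.{u}} (p : SDist (Map f g)) {n : SimplexCategoryᵒᵖ} (y : g.X.obj n) :
    StdSimplex ℝ (Σ y : g.X.obj n, (f ⟶ fib g y)) :=
  p.toHom.app n y

theorem mapAt_map {f g : SScen.{u}} (p : SDist (Map f g)) {n m : SimplexCategoryᵒᵖ} (θ : n ⟶ m)
    (y : g.X.obj n) : mapAt p (g.X.map θ y) =
      (mapAt p y).map fun z => ⟨g.X.map θ z.1, z.2 ≫ fibMap g θ z.1⟩ :=
  NatTrans.naturality_apply p.toHom θ y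

theorem mapAt_map_fst {f g : SScen.{u}} (p : SDist (Map f g)) {n : SimplexCategoryᵒᵖ}
    (y : g.X.obj n) : (mapAt p y).map Sigma.fst = StdSimplex.single y :=
  congrArg (fun k : (Map f g).X ⟶ D.obj (Map f g).X => k.app n y) p.w

theorem mapAt_sConvexComb {f g : SScen.{u}} (s : StdSimplex ℝ (SDist (Map f g)))
    {n : SimplexCategoryᵒᵖ} (y : g.X.obj n) :
    mapAt s.sConvexComb y = s.iConvexComb fun p => mapAt p y := rfl

theorem evalHom_comp {f g : SScen.{u}} {n m : SimplexCategoryᵒᵖ} (θ : n ⟶ m) (q : SDist f)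
    (z : Σ y : g.X.obj n, (f ⟶ fib g y)) :
    evalHom q ⟨g.X.map θ z.1, z.2 ≫ fibMap g θ z.1⟩ = (evalHom q z).map (g.E.map θ) :=
  (congrArg (evalTop g _) (SDist.push_comp z.2 (fibMap g θ z.1) q)).trans
    (evalTop_push_fibMap g θ z.1 _)

theorem evalHom_iConvexComb {f g : SScen.{u}} {n : SimplexCategoryᵒᵖ} {I : Type*}
    (w : StdSimplex ℝ I) (q : I → SDist f) (z : Σ y : g.X.obj n, (f ⟶ fib g y)) :
    evalHom (w.iConvexComb q) z = w.iConvexComb fun i => evalHom (q i) z :=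
  (congrArg (evalTop g z.1) (SDist.push_iConvexComb z.2 w q)).trans
    (evalTop_iConvexComb g z.1 w _)

theorem evalHom_map_hom {f g : SScen.{u}} {n : SimplexCategoryᵒᵖ} (q : SDist f)
    (z : Σ y : g.X.obj n, (f ⟶ fib g y)) :
    (evalHom q z).map (g.hom.app n) = StdSimplex.single z.1 :=
  evalTop_map_hom g z.1 _

/-- The simplicial distribution `μ_{f,g}(p)(q)` on `g`. The distribution `p_y` is supported on the
fiber of `E(f, g)_n` over `y`, which is the set of morphisms `f → g_y`, and `μ_{f,g}(p)(q)_y` is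
the convex combination of the distributions `sDist(m)(q) ∈ sDist(g_y) ≅ D(g_n⁻¹(y))` over the
morphisms `m : f → g_y`, with weights given by `p_y`. -/
def muApply {f g : SScen.{u}} (p : SDist (Map f g)) (q : SDist f) : SDist g :=
  SDist.mk' (fun y => (mapAt p y).iConvexComb (evalHom q))
    (fun θ y => by
      rw [map_iConvexComb, mapAt_map, iConvexComb_map]
      exact congrArg (StdSimplex.iConvexComb _) (funext fun z => evalHom_comp θ q z))
    (fun {n} y => by
      rw [map_iConvexComb, show StdSimplex.map (g.hom.app n) ∘ evalHom (n := n) q =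
        fun z => StdSimplex.single z.1 from funext fun z => evalHom_map_hom q z,
        ← iConvexComb_map (mapAt p y) Sigma.fst StdSimplex.single, mapAt_map_fst,
        iConvexComb_single])

theorem muApply_iConvexComb {f g : SScen.{u}} (p : SDist (Map f g)) (s : StdSimplex ℝ (SDist f)) :
    muApply p s.sConvexComb = s.iConvexComb fun q => muApply p q := by
  refine SDist.ext_at fun n y => ?_
  rw [← iConvexComb_id' s, SDist.iConvexComb_at]
  refine Eq.trans ?_ (iConvexComb_comm (mapAt p y) s fun z q => evalHom q z)
  exact congrArg (StdSimplex.iConvexComb (mapAt p y))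
    (funext fun z => evalHom_iConvexComb s (fun q => q) z)

theorem sConvexComb_muApply {f g : SScen.{u}} (s : StdSimplex ℝ (SDist (Map f g))) (q : SDist f) :
    muApply s.sConvexComb q = s.iConvexComb fun p => muApply p q := by
  refine SDist.ext_at fun n y => ?_
  rw [SDist.iConvexComb_at]
  change (mapAt s.sConvexComb y).iConvexComb (evalHom q) =
    s.iConvexComb fun p => (mapAt p y).iConvexComb (evalHom q)
  rw [mapAt_sConvexComb, iConvexComb_assoc]

/-- The convex map `μ_{f,g}(p) : sDist(f) → sDist(g)`. -/
def muMap {f g : SScen.{u}} (p : SDist (Map f g)) :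
    ConvexSpace.AffineMap ℝ (SDist f) (SDist g) where
  toFun := muApply p
  isAffineMap_toFun := ⟨muApply_iConvexComb p⟩

/-- The convex map `μ_{f,g} : sDist(Map(f, g)) → Conv(sDist(f), sDist(g))`. -/
def mu (f g : SScen.{u}) : ConvexSpace.AffineMap ℝ (SDist (Map f g))
    (ConvexSpace.AffineMap ℝ (SDist f) (SDist g)) where
  toFun := muMap
  isAffineMap_toFun := ⟨fun s => ConvexSpace.AffineMap.ext (funext fun q =>
    (sConvexComb_muApply s q).trans (affineMap_iConvexComb_apply s muMap q).symm)⟩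

end SScen
end

noncomputable section

namespace SScen

/-! The point is that a section of `Map f g` is the same thing as a morphism `f ⟶ g`. A section
chooses a morphism `f → g_y` for every simplex `y` of `Y`, compatibly with the ordinal maps. Since
`Y` is glued from its simplices and `F` from the pullbacks `y^*(F)`, such a compatible family glues
to one morphism `f → g`, from which each member is recovered by composing with the canonical `g →
g_y` (`sectOfHom_homOfSect`).

Under this correspondence `μ` sends the deterministic distribution `δ ∘ s` to the map induced by the
corresponding morphism: the average defining `μ` is then taken over a point mass, and evaluating the
pullback of a distribution along `y` at the top simplex gives its value at `y`
(`mu_ofSect_sectOfHom`, `mu_ofSect`).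

Since `μ` is convex, it carries a mixture of sections to the mixture, with the same weights, of the
induced maps (`mu_Θ`). Hence both sides of the equivalence describe the same set of convex maps, and
weights are moved between sections and morphisms by push-forward. Only one of the two inverse
identities is needed, namely that every section comes from its glued morphism. -/

/-! ### Restricting a scenario to a simplex -/

/-- The canonical morphism `(y, Id) : g → g_y`. -/
def toFib (g : SScen.{u}) {n : SimplexCategoryᵒᵖ} (y : g.X.obj n) : g ⟶ fib g y :=
  Hom.mk (f := g) (g := fib g y) (SSet.yonedaEquiv (n := n.unop).symm y)
    (𝟙 (SimplicialScenario.pullback g.hom (SSet.yonedaEquiv (n := n.unop).symm y))) rfl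

theorem yonedaEquiv_symm_app_top {X : SSet.{u}} {n : SimplexCategoryᵒᵖ} (x : X.obj n) :
    (SSet.yonedaEquiv (n := n.unop).symm x).app n (top n) = x :=
  (SSet.yonedaEquiv (n := n.unop)).apply_symm_apply x

theorem yonedaEquiv_symm_map_app {X : SSet.{u}} {n m : SimplexCategoryᵒᵖ} (θ : n ⟶ m)
    (x : X.obj n) {k : SimplexCategoryᵒᵖ} (t : (SSet.stdSimplex.{u}.obj m.unop).obj k) :
    (SSet.yonedaEquiv (n := n.unop).symm x).app k ((SSet.stdSimplex.map θ.unop).app k t) =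
      (SSet.yonedaEquiv (n := m.unop).symm (X.map θ x)).app k t :=
  congrArg (fun j : SSet.stdSimplex.obj m.unop ⟶ X => j.app k t)
    (SSet.yonedaEquiv_symm_naturality_left (X := X) θ.unop x)

/-- Every simplex of `Δ^n` is the image of the nondegenerate simplex under an ordinal map. -/
theorem exists_map_top {n k : SimplexCategoryᵒᵖ} (t : (SSet.stdSimplex.{u}.obj n.unop).obj k) :
    ∃ θ : n ⟶ k, t = (SSet.stdSimplex.map θ.unop).app k (top k) :=
  ⟨(SSet.stdSimplex.objEquiv t).op, SSet.stdSimplex.objEquiv.injective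
    (Category.id_comp (SSet.stdSimplex.objEquiv t)).symm⟩

/-- The event map of `toFib` is the identity, so the push-forward is just the pullback of `r` along
`y`. Its first marginal at the top simplex is `r` at the image of that simplex, which is `y`. -/
theorem evalTop_push_toFib (g : SScen.{u}) {n : SimplexCategoryᵒᵖ} (y : g.X.obj n)
    (r : SDist g) : evalTop g y (SDist.push (toFib g y) r) = r.at' y := by
  refine (StdSimplex.map_map _ _ _).trans ?_
  refine (glue_map_fst _ _ _ _ _).trans ?_
  exact congrArg r.at' (yonedaEquiv_symm_app_top y)

/-! ### From morphisms to sections -/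

variable {f g : SScen.{u}}

/-- By naturality of Yoneda, the map classifying the restricted simplex is the one classifying `y`
precomposed with `θ`. This is the compatibility that makes `sectOfHom` simplicial. -/
theorem comp_toFib_map (a : f ⟶ g) {n m : SimplexCategoryᵒᵖ} (θ : n ⟶ m) (y : g.X.obj n) :
    (⟨g.X.map θ y, a ≫ toFib g (g.X.map θ y)⟩ : Σ y : g.X.obj m, (f ⟶ fib g y)) =
      ⟨g.X.map θ y, (a ≫ toFib g y) ≫ fibMap g θ y⟩ :=
  mapE_ext rfl
    (fun k t => congrArg (a.π.app k) (yonedaEquiv_symm_map_app θ y t).symm)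
    (fun k _ t _ _ => congrArg (a.α.app k)
      (Subtype.ext (Prod.ext rfl (yonedaEquiv_symm_map_app θ y t).symm)))

/-- The section of the mapping scenario given by a morphism `f → g`: it sends a simplex `y` to the
composite `f → g → g_y`. -/
def sectOfHom (a : f ⟶ g) : Sect (Map f g) where
  val :=
    { app := fun _ => ↾(fun y => ⟨y, a ≫ toFib g y⟩)
      naturality := fun _ _ θ => ConcreteCategory.hom_ext _ _ fun y => comp_toFib_map a θ y }
  property := rfl

/-- At each `y` the average runs over a point mass, so only the morphism `a ≫ toFib g y`
contributes. Functoriality of push-forward then reduces the claim to `evalTop_push_toFib`. -/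
theorem mu_ofSect_sectOfHom (a : f ⟶ g) :
    mu f g (SDist.ofSect (sectOfHom a)) = sDistMap a := by
  refine ConvexSpace.AffineMap.ext (funext fun q => SDist.ext_at fun n y => ?_)
  refine (iConvexComb_single (R := ℝ) (⟨y, a ≫ toFib g y⟩ : Σ y : g.X.obj n, (f ⟶ fib g y))
    (evalHom q)).trans ?_
  exact (congrArg (evalTop g y) (SDist.push_comp a (toFib g y) q)).trans
    (evalTop_push_toFib g y _)

/-! ### From sections to morphisms -/

/-- The value of a section of the mapping scenario at a simplex. -/
def Sect.at' (s : Sect (Map f g)) {n : SimplexCategoryᵒᵖ} (y : g.X.obj n) :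
    Σ y : g.X.obj n, (f ⟶ fib g y) :=
  s.1.app n y

theorem Sect.at'_fst (s : Sect (Map f g)) {n : SimplexCategoryᵒᵖ} (y : g.X.obj n) :
    (s.at' y).1 = y :=
  congrArg (fun k : g.X ⟶ g.X => k.app n y) s.2

theorem Sect.at'_map (s : Sect (Map f g)) {n m : SimplexCategoryᵒᵖ} (θ : n ⟶ m)
    (y : g.X.obj n) :
    s.at' (g.X.map θ y) = ⟨g.X.map θ (s.at' y).1, (s.at' y).2 ≫ fibMap g θ (s.at' y).1⟩ :=
  NatTrans.naturality_apply s.1 θ y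

/-- The action on measurements of a morphism `f → g_y`, at the nondegenerate simplex of `Δ^n`. -/
def topπ {n : SimplexCategoryᵒᵖ} (z : Σ y : g.X.obj n, (f ⟶ fib g y)) : f.X.obj n :=
  z.2.π.app n (top n)

/-- The action on events of a morphism `f → g_y`, at the nondegenerate simplex of `Δ^n`. -/
def topα {n : SimplexCategoryᵒᵖ} (z : Σ y : g.X.obj n, (f ⟶ fib g y)) (e : f.E.obj n)
    (h : f.hom.app n e = topπ z) : g.E.obj n :=
  (z.2.α.app n ⟨(e, top n), h⟩).1.1

/-- The proof argument depends on `z`, so replacing `z` by an equal simplex needs this transport. -/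
theorem topα_congr {n : SimplexCategoryᵒᵖ} {z z' : Σ y : g.X.obj n, (f ⟶ fib g y)}
    (hz : z = z') (e : f.E.obj n) (h : f.hom.app n e = topπ z)
    (h' : f.hom.app n e = topπ z') : topα z e h = topα z' e h' := by
  subst hz; rfl

theorem hom_topα {n : SimplexCategoryᵒᵖ} (z : Σ y : g.X.obj n, (f ⟶ fib g y)) (e : f.E.obj n)
    (h : f.hom.app n e = topπ z) : g.hom.app n (topα z e h) = z.1 := by
  refine (z.2.α.app n ⟨(e, top n), h⟩).2.trans ?_
  refine Eq.trans ?_ (yonedaEquiv_symm_app_top z.1)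
  exact congrArg _ (z.2.w_apply ⟨(e, top n), h⟩)

/-- Simpliciality of `s` turns evaluation at the top simplex over a restriction of `y` into
evaluation at the simplex `θ` of `Δ^n` over `y` itself. Thus the top values of a section determine
all its values; `topα_at'_map` is the analogue for events. -/
theorem topπ_at'_map (s : Sect (Map f g)) {n m : SimplexCategoryᵒᵖ} (θ : n ⟶ m)
    (y : g.X.obj n) : topπ (s.at' (g.X.map θ y)) =
      (s.at' y).2.π.app m ((SSet.stdSimplex.map θ.unop).app m (top m)) := by
  rw [Sect.at'_map]; rfl

theorem topα_at'_map (s : Sect (Map f g)) {n m : SimplexCategoryᵒᵖ} (θ : n ⟶ m)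
    (y : g.X.obj n) (e : f.E.obj m) (h : f.hom.app m e = topπ (s.at' (g.X.map θ y))) :
    topα (s.at' (g.X.map θ y)) e h =
      ((s.at' y).2.α.app m ⟨(e, (SSet.stdSimplex.map θ.unop).app m (top m)),
        h.trans (topπ_at'_map s θ y)⟩).1.1 :=
  topα_congr (s.at'_map θ y) e h (h.trans (topπ_at'_map s θ y))

/-- The morphism `f → g` given by a section of the mapping scenario. -/
def homOfSect (s : Sect (Map f g)) : f ⟶ g :=
  Hom.mk (f := f) (g := g)
    { app := fun _ => ↾(fun y => topπ (s.at' y))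
      -- The simplex `θ` of `Δ^n` is also the restriction along `θ` of the top simplex, so
      -- naturality of the single component over `y` finishes the argument.
      naturality := fun n _ θ => ConcreteCategory.hom_ext _ _ fun y =>
        (topπ_at'_map s θ y).trans (NatTrans.naturality_apply (s.at' y).2.π θ (top n)) }
    { app := fun _ => ↾(fun z => topα (s.at' z.1.2) z.1.1 z.2)
      naturality := fun n _ θ => ConcreteCategory.hom_ext _ _ fun z =>
        (topα_at'_map s θ z.1.2 (f.E.map θ z.1.1) _).trans
          (congrArg (fun v => v.1.1)
            (NatTrans.naturality_apply (s.at' z.1.2).2.α θ ⟨(z.1.1, top n), z.2⟩)) }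
    (sset_hom_ext fun _ z => (hom_topα _ _ _).trans (s.at'_fst z.1.2))

/-- The glued morphism remembers only top values, but every simplex of `Δ^n` is an ordinal image of
the top one, so compatibility of `s` recovers the rest. -/
theorem sectOfHom_homOfSect (s : Sect (Map f g)) : sectOfHom (homOfSect s) = s := by
  refine Subtype.ext (sset_hom_ext fun n y => ?_)
  -- The base simplex of `s.at' y` is only propositionally `y`; comparing values componentwise
  -- avoids casting morphisms between different `fib g _`.
  refine mapE_ext (s.at'_fst y).symm (fun k t => ?_) (fun k e t h h' => ?_)
  · obtain ⟨θ, rfl⟩ := exists_map_top t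
    have hy : (SSet.yonedaEquiv (n := n.unop).symm y).app k
        ((SSet.stdSimplex.map θ.unop).app k (top k)) = g.X.map θ y :=
      (yonedaEquiv_symm_map_app θ y (top k)).trans (yonedaEquiv_symm_app_top _)
    exact (congrArg (fun v => topπ (s.at' v)) hy).trans (topπ_at'_map s θ y)
  · obtain ⟨θ, rfl⟩ := exists_map_top t
    have hy : (SSet.yonedaEquiv (n := n.unop).symm y).app k
        ((SSet.stdSimplex.map θ.unop).app k (top k)) = g.X.map θ y :=
      (yonedaEquiv_symm_map_app θ y (top k)).trans (yonedaEquiv_symm_app_top _)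
    have h1 : f.hom.app k e = topπ (s.at' (g.X.map θ y)) := h'.trans (topπ_at'_map s θ y).symm
    exact (topα_congr (congrArg s.at' hy) e h h1).trans (topα_at'_map s θ y e h1)

/-! ### The map `μ` on noncontextual distributions -/

theorem mu_ofSect (s : Sect (Map f g)) :
    mu f g (SDist.ofSect s) = sDistMap (homOfSect s) := by
  rw [← mu_ofSect_sectOfHom, sectOfHom_homOfSect]

theorem mu_Θ (d : StdSimplex ℝ (Sect (Map f g))) :
    mu f g (SDist.Θ _ d) = d.iConvexComb fun s => mu f g (SDist.ofSect s) :=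
  (mu f g).isAffineMap.map_iConvexComb d SDist.ofSect

end SScen
end

theorem theorem4 (f g : SScen.{u})
    (φ : ConvexSpace.AffineMap ℝ (SScen.SDist f) (SScen.SDist g)) :
    (∃ w : StdSimplex ℝ (f ⟶ g), φ = w.iConvexComb fun a => SScen.sDistMap a) ↔
      ∃ p : SScen.SDist (SScen.Map f g), p.Noncontextual ∧ φ = SScen.mu f g p := by
  constructor
  · rintro ⟨w, rfl⟩
    -- Reading each morphism as a section turns the given mixture into a noncontextual distribution
    -- with the same weights.
    refine ⟨SScen.SDist.Θ _ (w.map SScen.sectOfHom), ⟨_, rfl⟩, ?_⟩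
    rw [SScen.mu_Θ, iConvexComb_map]
    exact congrArg w.iConvexComb (funext fun a => (SScen.mu_ofSect_sectOfHom a).symm)
  · rintro ⟨_, ⟨d, rfl⟩, rfl⟩
    -- Conversely, gluing each section in the mixture to a morphism supplies the weights on `f ⟶ g`.
    refine ⟨d.map SScen.homOfSect, ?_⟩
    rw [SScen.mu_Θ, iConvexComb_map]
    exact congrArg d.iConvexComb (funext SScen.mu_ofSect)
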